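/- Let $\mathcal H$ be a real Hilbert space and let $K\subset\mathcal H$ be non-empty, closed and convex. Let $g:K\times K\to\mathbb R$ be a bifunction that is monotone ($g(x,y)+g(y,x)\le 0$ for all $x,y\in K$), upper hemicontinuous ($\limsup_{t\downarrow 0} g(tx_1+(1-t)x_2,y)\le g(x_2,y)$ for all $x_1,x_2,y\in K$), and such that for every $x\in K$ one has $g(x,x)=0$ and $g(x,\cdot)$ is convex and lower semicontinuous on $K$. Let $B:\mathcal H\to\mathcal H$ be monotone ($\langle Bx-By,x-y\rangle\ge 0$) and $L$-Lipschitz with $L>0$. For every $\lambda>0$ and $x\in\mathcal H$ there is exactly one point $J_\lambda^g(x)\in K$ with $$g(J_\lambda^g(x),y)+\tfrac1\lambda\langle J_\lambda^g(x)-x,\;y-J_\lambda^g(x)\rangle\ge 0\qquad\text{for all }y\in K,$$ so that for $\lambda,\beta>0$ and $x\in\mathcal H$ one may define $$h(\lambda,\beta,x)=\big((I-\lambda\beta B)\circ J_\lambda^g\circ(I-\lambda\beta B)-(I-\lambda\beta B)\big)x .$$ Let $\alpha>0$ and let $\lambda:[0,\infty)\to(0,\alpha)$ and $\beta:[0,\infty)\to(0,\infty)$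 be Lebesgue measurable functions such that $\lambda\beta$ is bounded on every bounded interval $[0,T]$ and $$0<\limsup_{t\to\infty}\lambda(t)\beta(t)<\frac1L .$$ Then for each $x_0\in\mathcal H$ there exists a unique strong global solution $x:[0,\infty)\to\mathcal H$ of $$\dot x(t)=h(\lambda(t),\beta(t),x(t)),\qquad x(0)=x_0,$$ that is, a unique function $x$ that is absolutely continuous on $[0,b]$ for every $b>0$, satisfies the differential equation for almost every $t\in[0,\infty)$, and satisfies $x(0)=x_0$. -/

import Mathlib

open Set Filter Topology MeasureTheory

noncomputable section

namespace FBF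

variable {H : Type*} [NormedAddCommGroup H] [InnerProductSpace ℝ H]

/-- Monotonicity on `K × K` of a bifunction. Only the values of `g` on `K × K` are used
here and in all the definitions below. -/
def BifunMonotone (K : Set H) (g : H → H → ℝ) : Prop :=
  ∀ x ∈ K, ∀ y ∈ K, g x y + g y x ≤ 0

/-- Upper hemicontinuity on `K × K`: `limsup_{t ↓ 0} g (t x₁ + (1 - t) x₂, y) ≤ g (x₂, y)`. -/
def UpperHemicontinuous (K : Set H) (g : H → H → ℝ) : Prop :=
  ∀ x₁ ∈ K, ∀ x₂ ∈ K, ∀ y ∈ K,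
    limsup (fun t : ℝ => ((g (t • x₁ + (1 - t) • x₂) y : ℝ) : EReal)) (𝓝[>] 0)
      ≤ ((g x₂ y : ℝ) : EReal)

/-- Equilibrium bifunction on `K × K`. -/
def IsEquilibriumBifun (K : Set H) (g : H → H → ℝ) : Prop :=
  ∀ x ∈ K, g x x = 0 ∧ ConvexOn ℝ K (g x) ∧ LowerSemicontinuousOn (g x) K

/-- The set-valued resolvent `J_r^g(x)` of the bifunction `g : K × K → ℝ`. -/
def bifunResolventSet (K : Set H) (g : H → H → ℝ) (r : ℝ) (x : H) : Set H :=
  {z | z ∈ K ∧ ∀ y ∈ K, 0 ≤ g z y + (1 / r) * inner ℝ (z - x) (y - z)}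

/-- The resolvent as a point: the element of `bifunResolventSet K g r x` whenever that set
is a singleton. -/
def bifunResolvent (K : Set H) (g : H → H → ℝ) (r : ℝ) (x : H) : H :=
  Classical.epsilon fun z => z ∈ bifunResolventSet K g r x

/-- The forward step `I - l b B`. -/
def forwardStep (B : H → H) (l b : ℝ) (x : H) : H := x - (l * b) • B x

/-- The field `h(l, b, x) = ((I - l b B) ∘ J_l^g ∘ (I - l b B) - (I - l b B)) x`. -/
def fbfField (K : Set H) (g : H → H → ℝ) (B : H → H) (l b : ℝ) (x : H) : H :=
  forwardStep B l b (bifunResolvent K g l (forwardStep B l b x)) - forwardStep B l b x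

/-- Strong global solution on `[0, ∞)` of `x' = h(lam t, bet t, x)`, `x 0 = x₀`
(only the values of `x` on `[0, ∞)` matter). -/
structure IsStrongGlobalSolution (K : Set H) (g : H → H → ℝ) (B : H → H)
    (lam bet : ℝ → ℝ) (x₀ : H) (x : ℝ → H) : Prop where
  locallyAbsolutelyContinuous : ∀ b : ℝ, 0 < b → AbsolutelyContinuousOnInterval x 0 b
  hasDerivAt : ∀ᵐ t ∂(volume.restrict (Ici (0 : ℝ))),
    HasDerivAt x (fbfField K g B (lam t) (bet t) (x t)) t
  initial : x 0 = x₀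

end FBF

end

/-! For a fixed parameter the field is Lipschitz in space, so the theorem is a Cauchy–Lipschitz
statement of Carathéodory type. Two things have to be supplied: the resolvent, and bounds on the
field that are uniform in time.

Resolvent: the defining inequality is replaced by its dual, `g y w + c * ⟪w - z, w - y⟫ ≤ 0`. For
each fixed `y` this cuts out a closed convex set of `w`. Monotonicity and a minimax argument show
that finitely many of these sets meet; coercivity of the quadratic term makes them bounded, so all
of them meet. Minty's argument returns to the original inequality. Monotonicity also gives
uniqueness, nonexpansiveness in the point and a Lipschitz-type dependence on the parameter.

Flow: local boundedness and the limsup condition bound `lam * bet` on `[0, ∞)` by some `c`. This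
yields one Lipschitz constant for all times, while `lam < α` controls the field at `0`. A fixed
point in an exponentially weighted sup norm solves the integral equation, and a Gronwall argument
for absolutely continuous functions gives uniqueness. -/

namespace FBF

variable {H : Type*} [NormedAddCommGroup H] [InnerProductSpace ℝ H]

/-! ### Intersections of convex sets and a minimax lemma -/

/-- A family of closed convex sets in a Hilbert space, one of them bounded, has a common point as
soon as every finite subfamily has one. -/
theorem iInter_nonempty_of_isClosed_convex [CompleteSpace H] {ι : Type*} (C : ι → Set H)
    (hclosed : ∀ i, IsClosed (C i)) (hconv : ∀ i, Convex ℝ (C i))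
    (i₀ : ι) (hbdd : Bornology.IsBounded (C i₀))
    (hfin : ∀ S : Finset ι, (⋂ i ∈ S, C i).Nonempty) : (⋂ i, C i).Nonempty := by
  classical
  obtain ⟨R, hR⟩ := hbdd.exists_norm_le
  -- `p S` is the projection of `0` onto the finite intersection; inserting `i₀` keeps its norm
  -- below `R`. This replaces weak compactness.
  have hex : ∀ S : Finset ι, ∃ p ∈ ⋂ i ∈ insert i₀ S, C i,
      ∀ w ∈ ⋂ i ∈ insert i₀ S, C i, inner ℝ (0 - p) (w - p) ≤ 0 := by
    intro S
    have hc : Convex ℝ (⋂ i ∈ insert i₀ S, C i) := convex_iInter₂ fun i _ => hconv i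
    obtain ⟨v, hv, hvm⟩ := exists_norm_eq_iInf_of_complete_convex (hfin (insert i₀ S))
      (isClosed_biInter fun i _ => hclosed i).isComplete hc 0
    exact ⟨v, hv, (norm_eq_iInf_iff_real_inner_le_zero hc hv).1 hvm⟩
  choose p hp hpm using hex
  -- Obtuse-angle property of the projection: the squared norms increase along the net and control
  -- its distances, so boundedness forces it to be Cauchy.
  have key : ∀ S T : Finset ι, S ⊆ T → ‖p T - p S‖ ^ 2 ≤ ‖p T‖ ^ 2 - ‖p S‖ ^ 2 := by
    intro S T hST
    have hmem : p T ∈ ⋂ i ∈ insert i₀ S, C i :=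
      biInter_subset_biInter_left (Finset.insert_subset_insert i₀ hST) (hp T)
    have h := hpm S _ hmem
    have e := norm_add_sq_real (p S) (p T - p S)
    rw [add_sub_cancel] at e
    rw [zero_sub, inner_neg_left] at h
    linarith
  have hmono : Monotone fun S => ‖p S‖ ^ 2 := fun S T hST => by
    have := key S T hST
    have := sq_nonneg ‖p T - p S‖
    simp only
    linarith
  have hbd : BddAbove (range fun S => ‖p S‖ ^ 2) := by
    refine ⟨R ^ 2, ?_⟩
    rintro _ ⟨S, rfl⟩
    have : p S ∈ C i₀ := mem_iInter₂.1 (hp S) i₀ (Finset.mem_insert_self _ _)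
    exact pow_le_pow_left₀ (norm_nonneg _) (hR _ this) 2
  have hcauchy : CauchySeq p := by
    rw [Metric.cauchySeq_iff']
    intro ε hε
    have ht := (tendsto_atTop_ciSup hmono hbd).cauchySeq
    obtain ⟨N, hN⟩ := Metric.cauchySeq_iff'.1 ht (ε ^ 2) (by positivity)
    refine ⟨N, fun T hT => ?_⟩
    have h1 := hN T hT
    rw [Real.dist_eq] at h1
    have h2 := key N T hT
    rw [dist_eq_norm]
    exact lt_of_pow_lt_pow_left₀ 2 hε.le (h2.trans_lt ((le_abs_self _).trans_lt h1))
  obtain ⟨w, hw⟩ := cauchySeq_tendsto_of_complete hcauchy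
  refine ⟨w, mem_iInter.2 fun i => (hclosed i).mem_of_tendsto hw ?_⟩
  filter_upwards [eventually_ge_atTop {i}] with S hS
  exact mem_iInter₂.1 (hp S) i (Finset.mem_insert_of_mem (hS (Finset.mem_singleton_self i)))

/-- A Ky Fan type lemma: if convex lower semicontinuous functions `φ i` on a convex set satisfy
`∑ i, q i * φ i (∑ j, q j • y j) ≤ 0` for all weights `q`, they have a common
nonpositivity point. -/
theorem exists_forall_nonpos_of_diagonal {ι : Type*} [Fintype ι] [Nonempty ι] {K : Set H}
    (hK : Convex ℝ K) (y : ι → H) (hy : ∀ i, y i ∈ K) (φ : ι → H → ℝ)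
    (hconv : ∀ i, ConvexOn ℝ K (φ i)) (hlsc : ∀ i, LowerSemicontinuousOn (φ i) K)
    (hdiag : ∀ q ∈ stdSimplex ℝ ι, ∑ i, q i * φ i (∑ j, q j • y j) ≤ 0) :
    ∃ w ∈ K, ∀ i, φ i w ≤ 0 := by
  classical
  let Λ : (ι → ℝ) →ₗ[ℝ] H := Fintype.linearCombination ℝ y
  have hΛ : ∀ p, Λ p = ∑ j, p j • y j := fun p => Fintype.linearCombination_apply ℝ y p
  have hΛc : Continuous Λ := Λ.continuous_of_finiteDimensional
  have hmaps : MapsTo Λ (stdSimplex ℝ ι) K := fun p hp => by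
    rw [hΛ]
    exact hK.sum_mem (fun i _ => hp.1 i) hp.2 fun i _ => hy i
  have hne : (stdSimplex ℝ ι).Nonempty :=
    ⟨_, single_mem_stdSimplex ℝ (Classical.arbitrary ι)⟩
  have hsaddle : ∃ a ∈ stdSimplex ℝ ι, ∃ b ∈ stdSimplex ℝ ι, IsSaddlePointOn (stdSimplex ℝ ι)
      (stdSimplex ℝ ι) (fun p q : ι → ℝ => ∑ i, q i * φ i (Λ p)) a b := by
    refine Sion.exists_isSaddlePointOn hne (convex_stdSimplex ℝ ι)
      (isCompact_stdSimplex ℝ ι) ?_ ?_ (convex_stdSimplex ℝ ι) hne (isCompact_stdSimplex ℝ ι) ?_ ?_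
    · intro q hq
      refine lowerSemicontinuousOn_sum fun i _ => ?_
      have h1 : LowerSemicontinuousOn (fun p => φ i (Λ p)) (stdSimplex ℝ ι) :=
        (hlsc i).comp hΛc.continuousOn hmaps
      exact (continuous_const.mul continuous_id : Continuous fun t : ℝ => q i * t
        ).comp_lowerSemicontinuousOn h1 (fun s t hst => mul_le_mul_of_nonneg_left hst (hq.1 i))
    · intro q hq
      have : ConvexOn ℝ (stdSimplex ℝ ι) fun p => ∑ i, q i * φ i (Λ p) := by
        refine ⟨convex_stdSimplex ℝ ι, fun p hp p' hp' s t hs ht hst => ?_⟩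
        simp only [smul_eq_mul, Finset.mul_sum, ← Finset.sum_add_distrib]
        refine Finset.sum_le_sum fun i _ => ?_
        have h := (hconv i).2 (hmaps hp) (hmaps hp') hs ht hst
        rw [map_add, map_smul, map_smul]
        simp only [smul_eq_mul] at h
        nlinarith [mul_le_mul_of_nonneg_left h (hq.1 i)]
      exact this.quasiconvexOn
    · intro p hp
      exact (continuous_finsetSum _ fun i _ =>
        (continuous_apply i).mul continuous_const).continuousOn.upperSemicontinuousOn
    · intro p hp
      have : ConcaveOn ℝ (stdSimplex ℝ ι) fun q : ι → ℝ => ∑ i, q i * φ i (Λ p) := by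
        refine ⟨convex_stdSimplex ℝ ι, fun q _ q' _ s t _ _ _ => le_of_eq ?_⟩
        simp only [smul_eq_mul, Finset.mul_sum, ← Finset.sum_add_distrib]
        refine Finset.sum_congr rfl fun i _ => ?_
        simp only [Pi.add_apply, Pi.smul_apply, smul_eq_mul]
        ring
      exact this.quasiconcaveOn
  obtain ⟨a, ha, b, hb, hab⟩ := hsaddle
  refine ⟨Λ a, hmaps ha, fun i => ?_⟩
  -- Saddle inequality with competitors `b` and the vertex `i`: the left side is `φ i (Λ a)`, the
  -- right side is the diagonal value at `b`.
  have h1 := hab b hb _ (single_mem_stdSimplex ℝ i)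
  have h2 := hdiag b hb
  rw [← hΛ] at h2
  simpa [Pi.single_apply] using h1.trans h2

/-! ### The resolvent of a monotone bifunction -/

section Resolvent

variable {K : Set H} {g : H → H → ℝ}

/-- A convex lower semicontinuous function vanishing at `y` decreases at most linearly. -/
theorem exists_linear_lower_bound {f : H → ℝ} {y : H} (hy : y ∈ K) (h0 : f y = 0)
    (hconv : ConvexOn ℝ K f) (hlsc : LowerSemicontinuousOn f K) :
    ∃ M : ℝ, 0 ≤ M ∧ ∀ w ∈ K, -1 - M * ‖w - y‖ ≤ f w := by
  have h1 := hlsc y hy (-1) (by simp [h0])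
  obtain ⟨δ, hδ, hδ'⟩ := Metric.mem_nhdsWithin_iff.1 h1
  refine ⟨2 / δ, by positivity, fun w hw => ?_⟩
  have hM : 0 ≤ 2 / δ * ‖w - y‖ := by positivity
  rcases lt_or_ge ‖w - y‖ δ with h | h
  · have : -1 < f w := hδ' ⟨by simpa [dist_eq_norm] using h, hw⟩
    linarith
  · have hpos : 0 < ‖w - y‖ := hδ.trans_le h
    -- Puts the point of the segment from `y` to `w` at distance `δ / 2` from `y`, where the local
    -- bound `-1` holds; convexity carries it out to `w`.
    set s : ℝ := δ / (2 * ‖w - y‖) with hs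
    have hs0 : 0 < s := by positivity
    have hs1 : s ≤ 1 := by
      rw [hs, div_le_one (by positivity)]; linarith
    have hsn : s * ‖w - y‖ = δ / 2 := by rw [hs]; field_simp
    have hmem := hconv.1 hy hw (sub_nonneg.2 hs1) hs0.le (by ring)
    have hle := hconv.2 hy hw (sub_nonneg.2 hs1) hs0.le (by ring)
    have hball : (1 - s) • y + s • w ∈ Metric.ball y δ := by
      have : (1 - s) • y + s • w - y = s • (w - y) := by module
      rw [Metric.mem_ball, dist_eq_norm, this, norm_smul, Real.norm_of_nonneg hs0.le, hsn]
      linarith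
    have h2 : -1 < f ((1 - s) • y + s • w) := hδ' ⟨hball, hmem⟩
    rw [h0] at hle
    simp only [smul_eq_mul, mul_zero, zero_add] at hle
    have h3 : -1 < s * f w := h2.trans_le hle
    have h4 : s * (2 / δ * ‖w - y‖) = 1 := by
      rw [mul_left_comm, hsn]; field_simp
    nlinarith

/-- The quadratic part is `‖w‖ ^ 2`, so the convexity defect is exactly `a * b * ‖u - v‖ ^ 2`. -/
theorem convexOn_inner_sub_sub (hK : Convex ℝ K) (z y : H) :
    ConvexOn ℝ K fun w => inner ℝ (w - z) (w - y) := by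
  refine ⟨hK, fun u _ v _ a b ha hb hab => ?_⟩
  have e1 : a • u + b • v - z = a • (u - z) + b • (v - z) := by
    obtain rfl : b = 1 - a := by linarith
    module
  have e2 : a • u + b • v - y = a • (u - y) + b • (v - y) := by
    obtain rfl : b = 1 - a := by linarith
    module
  have e3 : inner ℝ (u - z) (v - y) + inner ℝ (v - z) (u - y)
      = inner ℝ (u - z) (u - y) + inner ℝ (v - z) (v - y) - inner ℝ (u - v) (u - v) := by
    simp only [inner_sub_left, inner_sub_right]
    ring
  have h0 : 0 ≤ inner ℝ (u - v) (u - v) := real_inner_self_nonneg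
  simp only [e1, e2]
  simp only [inner_add_left, inner_add_right, real_inner_smul_left, real_inner_smul_right,
    smul_eq_mul]
  obtain rfl : b = 1 - a := by linarith
  have e4 := congrArg (fun t => a * (1 - a) * t) e3
  nlinarith [mul_nonneg (mul_nonneg ha hb) h0]

/-- Adding the double sum to its transpose pairs `g (y i) (y j)` with `g (y j) (y i)`. -/
theorem sum_mul_bifun_nonpos {E ι : Type*} [Fintype ι] {K : Set E} {g : E → E → ℝ}
    (hg : BifunMonotone K g) (y : ι → E) (hy : ∀ i, y i ∈ K) (q : ι → ℝ) (hq : ∀ i, 0 ≤ q i) :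
    ∑ i, ∑ j, q i * (q j * g (y i) (y j)) ≤ 0 := by
  have hswap : ∑ i, ∑ j, q i * (q j * g (y i) (y j)) = ∑ i, ∑ j, q i * (q j * g (y j) (y i)) := by
    rw [Finset.sum_comm]
    exact Finset.sum_congr rfl fun i _ => Finset.sum_congr rfl fun j _ => by ring
  have h : ∑ i, ∑ j, q i * (q j * g (y i) (y j)) + ∑ i, ∑ j, q i * (q j * g (y i) (y j)) ≤ 0 := by
    nth_rewrite 2 [hswap]
    simp only [← Finset.sum_add_distrib]
    refine Finset.sum_nonpos fun i _ => Finset.sum_nonpos fun j _ => ?_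
    rw [← mul_add, ← mul_add]
    exact mul_nonpos_of_nonneg_of_nonpos (hq i)
      (mul_nonpos_of_nonneg_of_nonpos (hq j) (hg _ (hy i) _ (hy j)))
  linarith

/-- Solutions of the dual (Minty) inequality. -/
theorem exists_minty_solution [CompleteSpace H] (hKne : K.Nonempty) (hKclosed : IsClosed K)
    (hKconv : Convex ℝ K) (hgmono : BifunMonotone K g) (hgeq : IsEquilibriumBifun K g)
    {c : ℝ} (hc : 0 < c) (z : H) :
    ∃ w ∈ K, ∀ y ∈ K, g y w + c * inner ℝ (w - z) (w - y) ≤ 0 := by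
  let φ : H → H → ℝ := fun y w => g y w + c * inner ℝ (w - z) (w - y)
  have hφc : ∀ y ∈ K, ConvexOn ℝ K (φ y) := fun y hy =>
    (hgeq y hy).2.1.add ((convexOn_inner_sub_sub hKconv z y).smul hc.le)
  have hφl : ∀ y ∈ K, LowerSemicontinuousOn (φ y) K := fun y hy =>
    (hgeq y hy).2.2.add ((by fun_prop : Continuous fun w : H =>
      c * inner ℝ (w - z) (w - y)).lowerSemicontinuous.lowerSemicontinuousOn K)
  let C : K → Set H := fun y => {w ∈ K | φ y w ≤ 0}
  obtain ⟨y₀, hy₀⟩ := hKne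
  have hcl : ∀ y, IsClosed (C y) := fun y => by
    obtain ⟨v, hv, hv'⟩ := lowerSemicontinuousOn_iff_preimage_Iic.1 (hφl y y.2) 0
    have : C y = K ∩ v := by rw [← hv']; rfl
    rw [this]
    exact hKclosed.inter hv
  have hcv : ∀ y, Convex ℝ (C y) := fun y => (hφc y y.2).convex_le 0
  -- `g y₀` decreases at most linearly while the inner product grows quadratically. Beyond the
  -- chosen radius the quadratic term exceeds the rest.
  have hbd : Bornology.IsBounded (C ⟨y₀, hy₀⟩) := by
    obtain ⟨M, hM, hMb⟩ := exists_linear_lower_bound hy₀ (hgeq y₀ hy₀).1 (hgeq y₀ hy₀).2.1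
      (hgeq y₀ hy₀).2.2
    refine (Metric.isBounded_closedBall (x := y₀)
      (r := 1 + (M / c + ‖y₀ - z‖ + 1 / c))).subset fun w hw => ?_
    rw [Metric.mem_closedBall, dist_eq_norm]
    by_contra! hlt
    have h1 := hMb w hw.1
    have h2 : g y₀ w + c * inner ℝ (w - z) (w - y₀) ≤ 0 := hw.2
    have h3 : inner ℝ (w - z) (w - y₀) = ‖w - y₀‖ ^ 2 + inner ℝ (y₀ - z) (w - y₀) := by
      rw [← real_inner_self_eq_norm_sq, ← inner_add_left]
      congr 1
      abel
    have h4 : -(‖y₀ - z‖ * ‖w - y₀‖) ≤ inner ℝ (y₀ - z) (w - y₀) :=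
      (abs_le.1 (abs_real_inner_le_norm _ _)).1
    have h5 : c * (M / c + ‖y₀ - z‖ + 1 / c) = M + c * ‖y₀ - z‖ + 1 := by field_simp
    rw [h3] at h2
    have hn : 0 ≤ ‖y₀ - z‖ := norm_nonneg _
    have hpos : 0 ≤ M / c + ‖y₀ - z‖ + 1 / c := by positivity
    have h6 : c * ‖w - y₀‖ > M + c * ‖y₀ - z‖ + 1 := by
      rw [← h5]
      exact mul_lt_mul_of_pos_left (by linarith) hc
    have h7 : 1 < ‖w - y₀‖ := by linarith
    have h8 := mul_lt_mul_of_pos_right h6 (by linarith : 0 < ‖w - y₀‖)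
    nlinarith [mul_le_mul_of_nonneg_left h4 hc.le]
  have hfin : ∀ S : Finset K, (⋂ y ∈ S, C y).Nonempty := by
    intro S
    rcases S.eq_empty_or_nonempty with rfl | hS
    · exact ⟨0, by simp⟩
    have : Nonempty S := hS.to_subtype
    have hcommon : ∃ w ∈ K, ∀ i : S, φ (i : K) w ≤ 0 := by
      refine exists_forall_nonpos_of_diagonal hKconv
        (fun i : S => ((i : K) : H)) (fun i => i.1.2) (fun i => φ (i : K))
        (fun i => hφc _ i.1.2) (fun i => hφl _ i.1.2) ?_
      intro q hq
      set v := ∑ j : S, q j • ((j : K) : H) with hv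
      -- `v` is the barycentre of the points, so the inner-product terms average to zero; only `g`
      -- remains, handled by Jensen and monotonicity.
      have h1 : ∑ i : S, q i * (c * inner ℝ (v - z) (v - ((i : K) : H))) = 0 := by
        have e : ∑ i : S, q i • (v - ((i : K) : H)) = 0 := by
          simp only [smul_sub, Finset.sum_sub_distrib, ← Finset.sum_smul, hq.2, one_smul, ← hv,
            sub_self]
        calc ∑ i : S, q i * (c * inner ℝ (v - z) (v - ((i : K) : H)))
            = c * inner ℝ (v - z) (∑ i : S, q i • (v - ((i : K) : H))) := by
              rw [inner_sum, Finset.mul_sum]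
              refine Finset.sum_congr rfl fun i _ => ?_
              rw [real_inner_smul_right]
              ring
          _ = 0 := by rw [e, inner_zero_right, mul_zero]
      have h2 : ∀ i : S, g (i : K) v ≤ ∑ j : S, q j * g (i : K) (j : K) := fun i =>
        (hgeq _ i.1.2).2.1.map_sum_le (fun j _ => hq.1 j) hq.2 fun j _ => j.1.2
      calc ∑ i : S, q i * φ (i : K) v
          = ∑ i : S, q i * g (i : K) v := by
            simp only [φ, mul_add, Finset.sum_add_distrib, h1, add_zero]
        _ ≤ ∑ i : S, ∑ j : S, q i * (q j * g (i : K) (j : K)) := by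
            refine Finset.sum_le_sum fun i _ => ?_
            rw [← Finset.mul_sum]
            exact mul_le_mul_of_nonneg_left (h2 i) (hq.1 i)
        _ ≤ 0 := sum_mul_bifun_nonpos hgmono (fun i : S => ((i : K) : H)) (fun i => i.1.2) q hq.1
    obtain ⟨w, hw, hw'⟩ := hcommon
    exact ⟨w, mem_iInter₂.2 fun y hy => ⟨hw, hw' ⟨y, hy⟩⟩⟩
  obtain ⟨w, hw⟩ := iInter_nonempty_of_isClosed_convex C hcl hcv ⟨y₀, hy₀⟩ hbd hfin
  exact ⟨w, (mem_iInter.1 hw ⟨y₀, hy₀⟩).1, fun y hy => (mem_iInter.1 hw ⟨y, hy⟩).2⟩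

/-- Minty's lemma: a solution of the dual inequality belongs to the resolvent. -/
theorem mem_bifunResolventSet_of_minty (hKconv : Convex ℝ K)
    (hghemi : UpperHemicontinuous K g) (hgeq : IsEquilibriumBifun K g) {r : ℝ} {z w : H}
    (hw : w ∈ K) (hmin : ∀ y ∈ K, g y w + (1 / r) * inner ℝ (w - z) (w - y) ≤ 0) :
    w ∈ bifunResolventSet K g r z := by
  refine ⟨hw, fun y hy => ?_⟩
  set d : ℝ := (1 / r) * inner ℝ (w - z) (y - w) with hd
  -- Test the dual inequality at `u = t • y + (1 - t) • w`. Convexity of `g u` and `g u u = 0` give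
  -- `0 ≤ t * g u y + (1 - t) * g u w`, with `g u w ≤ t * d`; dividing by `t` prepares the limit `t
  -- ↓ 0`.
  have hlow : ∀ t ∈ Ioo (0 : ℝ) 1, -((1 - t) * d) ≤ g (t • y + (1 - t) • w) y := by
    intro t ht
    have ht1 : 0 ≤ 1 - t := by linarith [ht.2]
    have hmem := hKconv hy hw ht.1.le ht1 (by ring)
    set u := t • y + (1 - t) • w with hu
    have h1 := (hgeq u hmem).2.1.2 hy hw ht.1.le ht1 (by ring)
    rw [← hu, (hgeq u hmem).1] at h1
    have h2 := hmin u hmem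
    have e : w - u = -(t • (y - w)) := by rw [hu]; module
    rw [e, inner_neg_right, real_inner_smul_right] at h2
    simp only [smul_eq_mul] at h1
    have h3 : g u w ≤ t * d := by rw [hd]; linarith
    have h4 : 0 ≤ t * (g u y + (1 - t) * d) := by
      nlinarith [mul_le_mul_of_nonneg_left h3 ht1]
    have := nonneg_of_mul_nonneg_right h4 ht.1
    linarith
  have hlim : Tendsto (fun t : ℝ => (((-((1 - t) * d) : ℝ)) : EReal)) (𝓝[>] 0)
      (𝓝 ((-d : ℝ) : EReal)) := by
    refine (continuous_coe_real_ereal.tendsto _).comp ?_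
    have : Continuous fun t : ℝ => -((1 - t) * d) := by fun_prop
    simpa using (this.tendsto 0).mono_left nhdsWithin_le_nhds
  have hle : ((-d : ℝ) : EReal) ≤ ((g w y : ℝ) : EReal) := by
    rw [← hlim.limsup_eq]
    refine le_trans (limsup_le_limsup ?_) (hghemi y hy w hw y hy)
    filter_upwards [Ioo_mem_nhdsGT (zero_lt_one (α := ℝ))] with t ht
    exact EReal.coe_le_coe_iff.2 (hlow t ht)
  have := EReal.coe_le_coe_iff.1 hle
  linarith

/-- Comparison of resolvent points for two parameters. -/
theorem inner_resolvent_comparison (hgmono : BifunMonotone K g) {r s : ℝ} {x z u v : H}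
    (hu : u ∈ bifunResolventSet K g r x) (hv : v ∈ bifunResolventSet K g s z) :
    0 ≤ (1 / r) * inner ℝ (u - x) (v - u) + (1 / s) * inner ℝ (v - z) (u - v) := by
  have h1 := hu.2 v hv.1
  have h2 := hv.2 u hu.1
  have h3 := hgmono u hu.1 v hv.1
  linarith

/-- The resolvents are nonexpansive. -/
theorem norm_sub_le_of_mem_bifunResolventSet (hgmono : BifunMonotone K g) {r : ℝ} (hr : 0 < r)
    {x z u v : H} (hu : u ∈ bifunResolventSet K g r x) (hv : v ∈ bifunResolventSet K g r z) :
    ‖u - v‖ ≤ ‖x - z‖ := by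
  have h := inner_resolvent_comparison hgmono hu hv
  rw [← mul_add] at h
  have h' := nonneg_of_mul_nonneg_right h (one_div_pos.2 hr)
  have e : inner ℝ (u - x) (v - u) + inner ℝ (v - z) (u - v)
      = inner ℝ (x - z) (u - v) - ‖u - v‖ ^ 2 := by
    rw [← real_inner_self_eq_norm_sq]
    simp only [inner_sub_left, inner_sub_right]
    ring
  rw [e] at h'
  have h2 : inner ℝ (x - z) (u - v) ≤ ‖x - z‖ * ‖u - v‖ := real_inner_le_norm _ _
  by_contra! hlt
  have : 0 < ‖u - v‖ := (norm_nonneg _).trans_lt hlt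
  nlinarith

/-- Dependence of the resolvent on its parameter. -/
theorem norm_sub_le_of_mem_bifunResolventSet_param (hgmono : BifunMonotone K g) {r s : ℝ}
    (hr : 0 < r) {z u v : H} (hu : u ∈ bifunResolventSet K g r z)
    (hv : v ∈ bifunResolventSet K g s z) : ‖u - v‖ ≤ |1 - r / s| * ‖v - z‖ := by
  have h := inner_resolvent_comparison hgmono hu hv
  have h1 := mul_nonneg hr.le h
  have e : r * ((1 / r) * inner ℝ (u - z) (v - u) + (1 / s) * inner ℝ (v - z) (u - v))
      = (1 - r / s) * inner ℝ (v - z) (v - u) - ‖u - v‖ ^ 2 := by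
    rw [← real_inner_self_eq_norm_sq]
    have e1 : r * ((1 / r) * inner ℝ (u - z) (v - u)) = inner ℝ (u - z) (v - u) := by
      field_simp
    rw [mul_add, e1]
    simp only [inner_sub_left, inner_sub_right]
    ring
  rw [e] at h1
  have h2 : (1 - r / s) * inner ℝ (v - z) (v - u) ≤ |1 - r / s| * (‖v - z‖ * ‖u - v‖) := by
    refine (le_abs_self _).trans ?_
    rw [abs_mul, norm_sub_rev u v]
    exact mul_le_mul_of_nonneg_left (abs_real_inner_le_norm _ _) (abs_nonneg _)
  by_contra! hlt
  have h3 : 0 < ‖u - v‖ := (by positivity : 0 ≤ |1 - r / s| * ‖v - z‖).trans_lt hlt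
  nlinarith

theorem existsUnique_mem_bifunResolventSet [CompleteSpace H] (hKne : K.Nonempty)
    (hKclosed : IsClosed K) (hKconv : Convex ℝ K) (hgmono : BifunMonotone K g)
    (hghemi : UpperHemicontinuous K g) (hgeq : IsEquilibriumBifun K g) {r : ℝ} (hr : 0 < r)
    (z : H) : ∃! w : H, w ∈ bifunResolventSet K g r z := by
  obtain ⟨w, hw, hmin⟩ := exists_minty_solution hKne hKclosed hKconv hgmono hgeq
    (one_div_pos.2 hr) z
  have hw' := mem_bifunResolventSet_of_minty hKconv hghemi hgeq hw hmin
  refine ⟨w, hw', fun v hv => ?_⟩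
  have := norm_sub_le_of_mem_bifunResolventSet hgmono hr hv hw'
  rw [sub_self, norm_zero] at this
  exact sub_eq_zero.1 (norm_le_zero_iff.1 this)

end Resolvent

/-! ### Carathéodory equations: global existence -/

section Caratheodory

variable {E : Type*} [NormedAddCommGroup E] [NormedSpace ℝ E]

/-- Integration against the weight `exp (a * s)` gains a factor `1 / a`; this is what makes the
Picard map contract on an unbounded interval. -/
theorem norm_exp_smul_integral_le {a D T : ℝ} (ha : 0 < a) (hD : 0 ≤ D) (hT : 0 ≤ T) {φ : ℝ → E}
    (hφ : ∀ s ∈ Ioc 0 T, ‖φ s‖ ≤ D * Real.exp (a * s)) :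
    ‖Real.exp (-(a * T)) • ∫ s in (0 : ℝ)..T, φ s‖ ≤ D / a := by
  have hint : ∫ s in (0 : ℝ)..T, D * Real.exp (a * s) = D / a * (Real.exp (a * T) - 1) := by
    rw [intervalIntegral.integral_const_mul, intervalIntegral.integral_comp_mul_left _ ha.ne',
      integral_exp]
    simp
    field_simp
  have h1 : ‖∫ s in (0 : ℝ)..T, φ s‖ ≤ D / a * (Real.exp (a * T) - 1) := by
    rw [← hint]
    exact intervalIntegral.norm_integral_le_of_norm_le hT (Eventually.of_forall hφ)
      (Continuous.intervalIntegrable (by fun_prop) _ _)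
  rw [norm_smul, Real.norm_of_nonneg (Real.exp_pos _).le]
  calc Real.exp (-(a * T)) * ‖∫ s in (0 : ℝ)..T, φ s‖
      ≤ Real.exp (-(a * T)) * (D / a * Real.exp (a * T)) := by
        refine mul_le_mul_of_nonneg_left (h1.trans ?_) (Real.exp_pos _).le
        exact mul_le_mul_of_nonneg_left (by linarith) (by positivity)
    _ = D / a := by
        rw [mul_left_comm, ← Real.exp_add, neg_add_cancel, Real.exp_zero, mul_one]

variable {f : ℝ → E → E} {k M : ℝ}

theorem norm_field_le {F : Type*} [NormedAddCommGroup F] {f : ℝ → F → F}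
    (hlip : ∀ t x y, ‖f t x - f t y‖ ≤ k * ‖x - y‖) (hM : ∀ t, ‖f t 0‖ ≤ M)
    (t : ℝ) (x : F) : ‖f t x‖ ≤ M + k * ‖x‖ := by
  have h := hlip t x 0
  rw [sub_zero] at h
  calc ‖f t x‖ = ‖f t 0 + (f t x - f t 0)‖ := by rw [add_sub_cancel]
    _ ≤ ‖f t 0‖ + ‖f t x - f t 0‖ := norm_add_le _ _
    _ ≤ M + k * ‖x‖ := add_le_add (hM t) h

theorem intervalIntegrable_field {F : Type*} [NormedAddCommGroup F] {f : ℝ → F → F}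
    (hlip : ∀ t x y, ‖f t x - f t y‖ ≤ k * ‖x - y‖)
    (hM : ∀ t, ‖f t 0‖ ≤ M)
    (hmeas : ∀ x : ℝ → F, Continuous x → AEStronglyMeasurable (fun t => f t (x t)) volume)
    {x : ℝ → F} (hx : Continuous x) (a b : ℝ) :
    IntervalIntegrable (fun t => f t (x t)) volume a b := by
  have h : IntervalIntegrable (fun t => M + k * ‖x t‖) volume a b :=
    Continuous.intervalIntegrable (by fun_prop) _ _
  refine h.mono_fun (hmeas x hx).restrict (Eventually.of_forall fun t => ?_)
  exact (norm_field_le hlip hM t (x t)).trans (le_abs_self _)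

/-- Global existence for the integral equation of a Carathéodory field that is globally Lipschitz
in the space variable. -/
theorem exists_integral_solution [CompleteSpace E] (hk : 0 < k)
    (hlip : ∀ t x y, ‖f t x - f t y‖ ≤ k * ‖x - y‖) (hM : ∀ t, ‖f t 0‖ ≤ M)
    (hmeas : ∀ x : ℝ → E, Continuous x → AEStronglyMeasurable (fun t => f t (x t)) volume)
    (x₀ : E) :
    ∃ x : ℝ → E, Continuous x ∧ ∀ t, 0 ≤ t → x t = x₀ + ∫ s in (0 : ℝ)..t, f s (x s) := by
  have hM0 : 0 ≤ M := (norm_nonneg _).trans (hM 0)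
  have ha : 0 < 2 * k := by positivity
  -- The unknown is `X y`, with `y` bounded. The rate `2 * k` gives contraction constant `k / (2 *
  -- k) = 1 / 2`; `max s 0` freezes the weight at negative times.
  let X : BoundedContinuousFunction ℝ E → ℝ → E := fun y s => Real.exp (2 * k * max s 0) • y s
  have hX : ∀ y, Continuous (X y) := fun y => by
    have := y.continuous
    fun_prop
  have hXn : ∀ y z : BoundedContinuousFunction ℝ E, ∀ s, 0 ≤ s →
      ‖X y s - X z s‖ ≤ ‖y - z‖ * Real.exp (2 * k * s) := fun y z s hs => by
    simp only [X, max_eq_left hs]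
    rw [← smul_sub, norm_smul, Real.norm_of_nonneg (Real.exp_pos _).le, mul_comm]
    exact mul_le_mul_of_nonneg_right ((y - z).norm_coe_le_norm s) (Real.exp_pos _).le
  have hXz : ∀ s, X 0 s = 0 := fun s => by simp [X]
  let Ψ : BoundedContinuousFunction ℝ E → ℝ → E := fun y t =>
    Real.exp (-(2 * k * max t 0)) • (x₀ + ∫ s in (0 : ℝ)..(max t 0), f s (X y s))
  have hΨc : ∀ y, Continuous (Ψ y) := fun y => by
    have h := intervalIntegral.continuous_primitive
      (fun a b => intervalIntegrable_field hlip hM hmeas (hX y) a b) 0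
    have h2 : Continuous fun t : ℝ => ∫ s in (0 : ℝ)..(max t 0), f s (X y s) :=
      h.comp (continuous_id.max continuous_const)
    exact Continuous.smul (by fun_prop) (continuous_const.add h2)
  have hΨb : ∀ y t, ‖Ψ y t‖ ≤ ‖x₀‖ + (M + k * ‖y‖) / (2 * k) := fun y t => by
    simp only [Ψ, smul_add]
    refine (norm_add_le _ _).trans (add_le_add ?_ ?_)
    · rw [norm_smul, Real.norm_of_nonneg (Real.exp_pos _).le]
      refine mul_le_of_le_one_left (norm_nonneg _) (Real.exp_le_one_iff.2 ?_)
      have : 0 ≤ max t 0 := le_max_right _ _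
      nlinarith
    · refine norm_exp_smul_integral_le ha (by positivity) (le_max_right _ _) fun s hs => ?_
      have h1 := norm_field_le hlip hM s (X y s)
      have h2 := hXn y 0 s hs.1.le
      rw [hXz, sub_zero, sub_zero] at h2
      have h3 : 1 ≤ Real.exp (2 * k * s) := Real.one_le_exp (mul_nonneg ha.le hs.1.le)
      nlinarith [mul_le_mul_of_nonneg_left h2 hk.le, mul_le_mul_of_nonneg_left h3 hM0]
  let Φ : BoundedContinuousFunction ℝ E → BoundedContinuousFunction ℝ E := fun y =>
    BoundedContinuousFunction.ofNormedAddCommGroup (Ψ y) (hΨc y) _ (hΨb y)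
  have hcontr : ContractingWith (1 / 2) Φ := by
    refine ⟨by rw [← NNReal.coe_lt_coe]; norm_num, LipschitzWith.of_dist_le_mul fun y z => ?_⟩
    rw [BoundedContinuousFunction.dist_le (by positivity)]
    intro t
    have hsub : Ψ y t - Ψ z t = Real.exp (-(2 * k * max t 0)) •
        ∫ s in (0 : ℝ)..(max t 0), (f s (X y s) - f s (X z s)) := by
      rw [intervalIntegral.integral_sub (intervalIntegrable_field hlip hM hmeas (hX y) _ _)
        (intervalIntegrable_field hlip hM hmeas (hX z) _ _)]
      simp only [Ψ]
      rw [← smul_sub, add_sub_add_left_eq_sub]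
    change dist (Ψ y t) (Ψ z t) ≤ _
    rw [dist_eq_norm, hsub, dist_eq_norm]
    have := norm_exp_smul_integral_le (T := max t 0) (D := k * ‖y - z‖)
      (φ := fun s => f s (X y s) - f s (X z s)) ha (by positivity) (le_max_right _ _)
      fun s hs => by
        have h1 := mul_le_mul_of_nonneg_left (hXn y z s hs.1.le) hk.le
        rw [← mul_assoc] at h1
        exact (hlip _ _ _).trans h1
    refine this.trans (le_of_eq ?_)
    push_cast
    field_simp
  obtain ⟨y, hy, -⟩ := hcontr.exists_fixedPoint 0 (edist_ne_top _ _)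
  refine ⟨X y, hX y, fun t ht => ?_⟩
  have h1 : y t = Ψ y t := (DFunLike.congr_fun hy t).symm
  simp only [X]
  rw [h1]
  simp only [Ψ, max_eq_left ht, smul_smul, ← Real.exp_add, add_neg_cancel, Real.exp_zero,
    one_smul]
  rfl

theorem absolutelyContinuousOnInterval_norm {F : Type*} [NormedAddCommGroup F] {x : ℝ → F} {a b : ℝ}
    (hx : AbsolutelyContinuousOnInterval x a b) :
    AbsolutelyContinuousOnInterval (fun t => ‖x t‖) a b := by
  rw [absolutelyContinuousOnInterval_iff] at hx ⊢
  intro ε hε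
  obtain ⟨δ, hδ, h⟩ := hx ε hε
  refine ⟨δ, hδ, fun I hI hI' => lt_of_le_of_lt (Finset.sum_le_sum fun i _ => ?_) (h I hI hI')⟩
  simpa only [dist_eq_norm, Real.norm_eq_abs] using abs_norm_sub_norm_le (x (I.2 i).1) (x (I.2 i).2)

end Caratheodory

/-! ### Regularity of primitives -/

section Integral

variable {E : Type*} [NormedAddCommGroup E] [NormedSpace ℝ E]

/-- A primitive is differentiable almost everywhere. -/
theorem ae_hasDerivAt_of_eq_integral [CompleteSpace E] {x φ : ℝ → E} {x₀ : E}
    (hφ : ∀ a b, IntervalIntegrable φ volume a b)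
    (hx : ∀ t, 0 ≤ t → x t = x₀ + ∫ s in (0 : ℝ)..t, φ s) :
    ∀ᵐ t ∂(volume.restrict (Ici (0 : ℝ))), HasDerivAt x (φ t) t := by
  have hloc : LocallyIntegrable φ volume := by
    intro t
    refine ⟨Ioc (t - 1) (t + 1), Ioc_mem_nhds (by linarith) (by linarith), ?_⟩
    exact (intervalIntegrable_iff_integrableOn_Ioc_of_le (by linarith)).1 (hφ _ _)
  -- The integral formula is known only for `t ≥ 0`, so the two-sided derivative at `0` is discarded
  -- as a null set.
  have h0 : ∀ᵐ t : ℝ, t ≠ 0 := by simp [ae_iff, measure_singleton]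
  rw [ae_restrict_iff' measurableSet_Ici]
  filter_upwards [LocallyIntegrable.ae_hasDerivAt_integral hloc, h0] with t ht ht0 ht'
  have hpos : 0 < t := lt_of_le_of_ne ht' (Ne.symm ht0)
  refine ((ht 0).const_add x₀).congr_of_eventuallyEq ?_
  filter_upwards [Ioi_mem_nhds hpos] with s hs
  exact hx s (le_of_lt hs)

/-- A primitive of a bounded function is absolutely continuous. -/
theorem absolutelyContinuousOnInterval_of_eq_integral {x φ : ℝ → E} {x₀ : E} {b C : ℝ}
    (hb : 0 ≤ b) (hφ : ∀ a b, IntervalIntegrable φ volume a b)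
    (hC : ∀ t ∈ Icc 0 b, ‖φ t‖ ≤ C)
    (hx : ∀ t, 0 ≤ t → x t = x₀ + ∫ s in (0 : ℝ)..t, φ s) :
    AbsolutelyContinuousOnInterval x 0 b := by
  have hC0 : 0 ≤ C := (norm_nonneg _).trans (hC 0 (left_mem_Icc.2 hb))
  have : LipschitzOnWith C.toNNReal x (uIcc 0 b) := by
    refine LipschitzOnWith.of_dist_le_mul fun s hs t ht => ?_
    rw [uIcc_of_le hb] at hs ht
    rw [hx s hs.1, hx t ht.1, dist_eq_norm, add_sub_add_left_eq_sub,
      intervalIntegral.integral_interval_sub_left (hφ _ _) (hφ _ _), Real.coe_toNNReal _ hC0,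
      Real.dist_eq]
    refine intervalIntegral.norm_integral_le_of_norm_le_const fun r hr => hC r ?_
    have := uIoc_subset_uIcc hr
    exact uIcc_subset_Icc ht hs this
  exact this.absolutelyContinuousOnInterval

end Integral

/-! ### Uniqueness by a Gronwall argument -/

section Uniqueness

variable {H : Type*} [NormedAddCommGroup H] [InnerProductSpace ℝ H]

/-- Uniqueness of absolutely continuous solutions. -/
theorem eq_of_ae_hasDerivAt {f : ℝ → H → H} {k : ℝ}
    (hlip : ∀ t, 0 ≤ t → ∀ x y, ‖f t x - f t y‖ ≤ k * ‖x - y‖) {x y : ℝ → H} {b : ℝ} (hb : 0 ≤ b)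
    (hx : AbsolutelyContinuousOnInterval x 0 b) (hy : AbsolutelyContinuousOnInterval y 0 b)
    (hx' : ∀ᵐ t ∂(volume.restrict (Ici (0 : ℝ))), HasDerivAt x (f t (x t)) t)
    (hy' : ∀ᵐ t ∂(volume.restrict (Ici (0 : ℝ))), HasDerivAt y (f t (y t)) t)
    (h0 : x 0 = y 0) : x b = y b := by
  -- Gronwall weight: the derivative of `‖x - y‖ ^ 2` is at most `2 * k` times itself, so `u` has
  -- nonpositive derivative almost everywhere. Absolute continuity turns this into `u b ≤ u 0 = 0`.
  set u : ℝ → ℝ := fun t => Real.exp (-(2 * k * t)) * (‖x t - y t‖ * ‖x t - y t‖) with hu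
  have hexp : AbsolutelyContinuousOnInterval (fun t => Real.exp (-(2 * k * t))) 0 b :=
    ContDiffOn.absolutelyContinuousOnInterval (ContDiff.contDiffOn (by fun_prop))
  have hn := absolutelyContinuousOnInterval_norm (hx.sub hy)
  have huac : AbsolutelyContinuousOnInterval u 0 b := hexp.mul (hn.mul hn)
  have hder : ∀ᵐ t ∂(volume.restrict (Ici (0 : ℝ))), deriv u t ≤ 0 := by
    filter_upwards [hx', hy', ae_restrict_mem measurableSet_Ici] with t h1 h2 ht
    have h3 := (h1.sub h2).norm_sq
    have h4 : HasDerivAt (fun t => Real.exp (-(2 * k * t)))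
        (Real.exp (-(2 * k * t)) * (-(2 * k))) t := by
      simpa using ((hasDerivAt_id t).const_mul (2 * k)).neg.exp
    have h5 := h4.mul h3
    have h6 : u = (fun t => Real.exp (-(2 * k * t))) * fun t => ‖(x - y) t‖ ^ 2 := by
      funext s
      simp [hu, sq]
    rw [h6, h5.deriv]
    have h7 : inner ℝ ((x - y) t) (f t (x t) - f t (y t)) ≤ k * ‖(x - y) t‖ ^ 2 := by
      refine (real_inner_le_norm _ _).trans ?_
      rw [sq, mul_left_comm]
      exact mul_le_mul_of_nonneg_left (hlip t ht _ _) (norm_nonneg _)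
    have h8 := Real.exp_pos (-(2 * k * t))
    nlinarith
  have hint := huac.integral_deriv_eq_sub
  have hle : ∫ t in (0 : ℝ)..b, deriv u t ≤ 0 := by
    rw [intervalIntegral.integral_of_le hb]
    exact integral_nonpos_of_ae (ae_restrict_of_ae_restrict_of_subset
      (fun t ht => le_of_lt ht.1) hder)
  have hu0 : u 0 = 0 := by simp [hu, h0]
  rw [hint, hu0, sub_zero] at hle
  have h1 : ‖x b - y b‖ * ‖x b - y b‖ ≤ 0 := by
    by_contra! hpos
    exact absurd hle (not_le.2 (mul_pos (Real.exp_pos _) hpos))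
  have h2 : ‖x b - y b‖ = 0 := mul_self_eq_zero.1 (le_antisymm h1 (mul_self_nonneg _))
  exact sub_eq_zero.1 (norm_eq_zero.1 h2)

end Uniqueness

/-! ### Estimates and measurability for the field -/

section Field

variable {H : Type*} [NormedAddCommGroup H] [InnerProductSpace ℝ H]
  {K : Set H} {g : H → H → ℝ} {B : H → H} {L : ℝ}

theorem bifunResolvent_mem (hres : ∀ r : ℝ, 0 < r → ∀ z : H, ∃! w : H, w ∈ bifunResolventSet K g r z)
    {r : ℝ} (hr : 0 < r) (z : H) : bifunResolvent K g r z ∈ bifunResolventSet K g r z :=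
  Classical.epsilon_spec (hres r hr z).exists

/-- Writing the parameter as an exponential makes the map well behaved on all of `ℝ × H`; joint
continuity combines nonexpansiveness with the parameter comparison. -/
theorem continuous_bifunResolvent_exp (hgmono : BifunMonotone K g)
    (hres : ∀ r : ℝ, 0 < r → ∀ z : H, ∃! w : H, w ∈ bifunResolventSet K g r z) :
    Continuous fun p : ℝ × H => bifunResolvent K g (Real.exp p.1) p.2 := by
  rw [continuous_iff_continuousAt]
  rintro ⟨s₀, u₀⟩
  rw [ContinuousAt, tendsto_iff_norm_sub_tendsto_zero]
  set J₀ := bifunResolvent K g (Real.exp s₀) u₀ with hJ₀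
  have hlim : Tendsto (fun p : ℝ × H =>
      ‖p.2 - u₀‖ + |1 - Real.exp p.1 / Real.exp s₀| * ‖J₀ - u₀‖) (𝓝 (s₀, u₀)) (𝓝 0) := by
    have hc : Continuous fun p : ℝ × H =>
      ‖p.2 - u₀‖ + |1 - Real.exp p.1 / Real.exp s₀| * ‖J₀ - u₀‖ := by fun_prop
    simpa [div_self (Real.exp_ne_zero s₀)] using hc.tendsto (s₀, u₀)
  refine squeeze_zero (fun _ => norm_nonneg _) (fun p => ?_) hlim
  have m1 := bifunResolvent_mem hres (Real.exp_pos p.1) p.2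
  have m2 := bifunResolvent_mem hres (Real.exp_pos p.1) u₀
  have m3 := bifunResolvent_mem hres (Real.exp_pos s₀) u₀
  calc ‖bifunResolvent K g (Real.exp p.1) p.2 - J₀‖
      ≤ ‖bifunResolvent K g (Real.exp p.1) p.2 - bifunResolvent K g (Real.exp p.1) u₀‖
        + ‖bifunResolvent K g (Real.exp p.1) u₀ - J₀‖ := norm_sub_le_norm_sub_add_norm_sub _ _ _
    _ ≤ _ := add_le_add (norm_sub_le_of_mem_bifunResolventSet hgmono (Real.exp_pos _) m1 m2)
        (norm_sub_le_of_mem_bifunResolventSet_param hgmono (Real.exp_pos _) m2 m3)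

theorem continuous_fbfField_exp (hgmono : BifunMonotone K g)
    (hres : ∀ r : ℝ, 0 < r → ∀ z : H, ∃! w : H, w ∈ bifunResolventSet K g r z)
    (hB : Continuous B) :
    Continuous fun p : (ℝ × ℝ) × H => fbfField K g B (Real.exp p.1.1) p.1.2 p.2 := by
  have hP : Continuous fun p : (ℝ × ℝ) × H => forwardStep B (Real.exp p.1.1) p.1.2 p.2 := by
    unfold forwardStep
    fun_prop
  have hJ : Continuous fun p : (ℝ × ℝ) × H =>
      bifunResolvent K g (Real.exp p.1.1) (forwardStep B (Real.exp p.1.1) p.1.2 p.2) :=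
    (continuous_bifunResolvent_exp hgmono hres).comp
      ((continuous_fst.comp continuous_fst).prodMk hP)
  have hPJ := hP.comp (continuous_fst.prodMk hJ)
  exact hPJ.sub hP

theorem norm_forwardStep_sub_le (hBlip : ∀ x y : H, ‖B x - B y‖ ≤ L * ‖x - y‖) {l b c : ℝ}
    (h0 : 0 ≤ l * b) (hc : l * b ≤ c) (x y : H) :
    ‖forwardStep B l b x - forwardStep B l b y‖ ≤ (1 + c * L) * ‖x - y‖ := by
  have e : forwardStep B l b x - forwardStep B l b y = (x - y) - (l * b) • (B x - B y) := by
    simp only [forwardStep]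
    module
  rw [e]
  refine (norm_sub_le _ _).trans ?_
  rw [norm_smul, Real.norm_of_nonneg h0, add_mul, one_mul, mul_assoc c]
  exact add_le_add_right (mul_le_mul hc (hBlip x y) (norm_nonneg _) (h0.trans hc)) _

/-- Two forward steps around a nonexpansive resolvent give the square; the subtracted forward step
gives the last summand. -/
theorem norm_fbfField_sub_le (hgmono : BifunMonotone K g)
    (hres : ∀ r : ℝ, 0 < r → ∀ z : H, ∃! w : H, w ∈ bifunResolventSet K g r z) (hL : 0 < L)
    (hBlip : ∀ x y : H, ‖B x - B y‖ ≤ L * ‖x - y‖) {l b c : ℝ} (hl : 0 < l)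
    (h0 : 0 ≤ l * b) (hc : l * b ≤ c) (x y : H) :
    ‖fbfField K g B l b x - fbfField K g B l b y‖
      ≤ ((1 + c * L) * (1 + c * L) + (1 + c * L)) * ‖x - y‖ := by
  have hc0 : 0 ≤ 1 + c * L := by have := mul_nonneg (h0.trans hc) hL.le; linarith
  set u := forwardStep B l b x
  set v := forwardStep B l b y
  have h1 : ‖u - v‖ ≤ (1 + c * L) * ‖x - y‖ := norm_forwardStep_sub_le hBlip h0 hc x y
  have h2 := norm_sub_le_of_mem_bifunResolventSet hgmono hl (bifunResolvent_mem hres hl u)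
    (bifunResolvent_mem hres hl v)
  have h3 := norm_forwardStep_sub_le hBlip h0 hc (bifunResolvent K g l u)
    (bifunResolvent K g l v)
  have e : fbfField K g B l b x - fbfField K g B l b y
      = (forwardStep B l b (bifunResolvent K g l u) - forwardStep B l b (bifunResolvent K g l v))
        - (u - v) := by
    simp only [fbfField, u, v]
    abel
  rw [e, add_mul, mul_assoc]
  refine (norm_sub_le _ _).trans (add_le_add (h3.trans ?_) h1)
  exact mul_le_mul_of_nonneg_left (h2.trans h1) hc0

/-- For `0 < l < α` the comparison factor `|1 - l / α|` is at most `1`, so the resolvent at `0` is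
bounded uniformly even as `l` tends to `0`. -/
theorem norm_fbfField_zero_le (hgmono : BifunMonotone K g)
    (hres : ∀ r : ℝ, 0 < r → ∀ z : H, ∃! w : H, w ∈ bifunResolventSet K g r z) (hL : 0 < L)
    (hBlip : ∀ x y : H, ‖B x - B y‖ ≤ L * ‖x - y‖) {l b c α : ℝ} (hl : 0 < l) (hlα : l < α)
    (h0 : 0 ≤ l * b) (hc : l * b ≤ c) :
    ‖fbfField K g B l b 0‖ ≤ (1 + c * L) * (c * ‖B 0‖ + 2 * ‖bifunResolvent K g α 0‖)
      + c * ‖B 0‖ + c * ‖B 0‖ := by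
  have hc0 : 0 ≤ 1 + c * L := by have := mul_nonneg (h0.trans hc) hL.le; linarith
  have hα : 0 < α := hl.trans hlα
  have hP : ‖forwardStep B l b 0‖ ≤ c * ‖B 0‖ := by
    rw [forwardStep, zero_sub, norm_neg, norm_smul, Real.norm_of_nonneg h0]
    exact mul_le_mul_of_nonneg_right hc (norm_nonneg _)
  set u := forwardStep B l b 0
  have h1 : ‖bifunResolvent K g l 0‖ ≤ 2 * ‖bifunResolvent K g α 0‖ := by
    have h := norm_sub_le_of_mem_bifunResolventSet_param hgmono hl
      (bifunResolvent_mem hres hl (0 : H)) (bifunResolvent_mem hres hα (0 : H))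
    rw [sub_zero] at h
    have h2 : |1 - l / α| ≤ 1 := by
      have h3 : l / α ≤ 1 := (div_le_one hα).2 hlα.le
      have h4 : 0 ≤ l / α := by positivity
      rw [abs_le]
      constructor <;> linarith
    have h3 := h.trans (mul_le_of_le_one_left (norm_nonneg _) h2)
    have h4 := norm_le_norm_add_norm_sub' (bifunResolvent K g l 0) (bifunResolvent K g α 0)
    linarith
  have h2 : ‖bifunResolvent K g l u‖ ≤ c * ‖B 0‖ + 2 * ‖bifunResolvent K g α 0‖ := by
    have h := norm_sub_le_of_mem_bifunResolventSet hgmono hl (bifunResolvent_mem hres hl u)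
      (bifunResolvent_mem hres hl (0 : H))
    rw [sub_zero] at h
    have h4 := norm_le_norm_add_norm_sub' (bifunResolvent K g l u) (bifunResolvent K g l 0)
    linarith
  have h3 := norm_forwardStep_sub_le hBlip h0 hc (bifunResolvent K g l u) 0
  rw [sub_zero] at h3
  have h4 := norm_le_norm_add_norm_sub' (forwardStep B l b (bifunResolvent K g l u)) u
  have h5 := mul_le_mul_of_nonneg_left h2 hc0
  have h6 : ‖fbfField K g B l b 0‖ ≤ ‖forwardStep B l b (bifunResolvent K g l u)‖ + ‖u‖ :=
    norm_sub_le _ _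
  linarith

theorem exists_bound_of_limsup_lt {p : ℝ → ℝ} {a : ℝ}
    (hbdd : ∀ T : ℝ, 0 < T → BddAbove (p '' Icc 0 T))
    (hlimsup : limsup (fun t : ℝ => ((p t : ℝ) : EReal)) atTop < (a : EReal)) :
    ∃ c, ∀ t, 0 ≤ t → p t ≤ c := by
  obtain ⟨T, hT⟩ := eventually_atTop.1 (eventually_lt_of_limsup_lt hlimsup)
  obtain ⟨C, hC⟩ := hbdd (max T 1) (by positivity)
  refine ⟨max C a, fun t ht => ?_⟩
  rcases le_total t (max T 1) with h | h
  · exact (hC (mem_image_of_mem _ ⟨ht, h⟩)).trans (le_max_left _ _)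
  · exact (EReal.coe_lt_coe_iff.1 (hT t ((le_max_left _ _).trans h))).le.trans (le_max_right _ _)

/-- The field along `x` is a jointly continuous map composed with the measurable data `(log (lam t),
bet t, x t)`. -/
theorem aestronglyMeasurable_fbfField (hgmono : BifunMonotone K g)
    (hres : ∀ r : ℝ, 0 < r → ∀ z : H, ∃! w : H, w ∈ bifunResolventSet K g r z)
    (hB : Continuous B) {lam bet : ℝ → ℝ}
    (hlam_meas : AEMeasurable lam (volume.restrict (Ici (0 : ℝ))))
    (hbet_meas : AEMeasurable bet (volume.restrict (Ici (0 : ℝ))))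
    (hlam : ∀ t : ℝ, 0 ≤ t → 0 < lam t) {x : ℝ → H} (hx : Continuous x) :
    AEStronglyMeasurable (fun t => fbfField K g B (lam t) (bet t) (x t))
      (volume.restrict (Ici (0 : ℝ))) := by
  have h1 : AEStronglyMeasurable (fun t => ((Real.log (lam t), bet t), x t))
      (volume.restrict (Ici (0 : ℝ))) :=
    ((Real.measurable_log.comp_aemeasurable hlam_meas).aestronglyMeasurable.prodMk
      hbet_meas.aestronglyMeasurable).prodMk hx.aestronglyMeasurable
  refine ((continuous_fbfField_exp hgmono hres hB).comp_aestronglyMeasurable h1).congr ?_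
  filter_upwards [ae_restrict_mem measurableSet_Ici] with t ht
  simp only [Real.exp_log (hlam t ht)]

end Field

end FBF

/-! ### Existence and uniqueness of the flow -/

theorem mainTheorem3 {H : Type*} [NormedAddCommGroup H] [InnerProductSpace ℝ H]
    [CompleteSpace H]
    (K : Set H) (hKne : K.Nonempty) (hKclosed : IsClosed K) (hKconv : Convex ℝ K)
    (g : H → H → ℝ) (hgmono : FBF.BifunMonotone K g)
    (hghemi : FBF.UpperHemicontinuous K g) (hgeq : FBF.IsEquilibriumBifun K g)
    (B : H → H) (L : ℝ) (hL : 0 < L)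
    (hBmono : ∀ x y : H, 0 ≤ inner ℝ (B x - B y) (x - y))
    (hBlip : ∀ x y : H, ‖B x - B y‖ ≤ L * ‖x - y‖)
    (α : ℝ) (hα : 0 < α) (lam bet : ℝ → ℝ)
    (hlam_meas : AEMeasurable lam (volume.restrict (Ici (0 : ℝ))))
    (hbet_meas : AEMeasurable bet (volume.restrict (Ici (0 : ℝ))))
    (hlam : ∀ t : ℝ, 0 ≤ t → 0 < lam t ∧ lam t < α)
    (hbet : ∀ t : ℝ, 0 ≤ t → 0 < bet t)
    (hbdd : ∀ T : ℝ, 0 < T → BddAbove ((fun t => lam t * bet t) '' Icc 0 T))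
    (hlimsup_pos : 0 < limsup (fun t : ℝ => ((lam t * bet t : ℝ) : EReal)) atTop)
    (hlimsup_lt : limsup (fun t : ℝ => ((lam t * bet t : ℝ) : EReal)) atTop
      < ((1 / L : ℝ) : EReal)) :
    (∀ r : ℝ, 0 < r → ∀ z : H, ∃! w : H, w ∈ FBF.bifunResolventSet K g r z) ∧
    ∀ x₀ : H, ∃ x : ℝ → H, FBF.IsStrongGlobalSolution K g B lam bet x₀ x ∧
      ∀ x' : ℝ → H, FBF.IsStrongGlobalSolution K g B lam bet x₀ x' →
        EqOn x' x (Ici 0) := by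
  have hres : ∀ r : ℝ, 0 < r → ∀ z : H, ∃! w : H, w ∈ FBF.bifunResolventSet K g r z :=
    fun r hr z => FBF.existsUnique_mem_bifunResolventSet hKne hKclosed hKconv hgmono hghemi hgeq
      hr z
  refine ⟨hres, fun x₀ => ?_⟩
  have hB : Continuous B := (LipschitzWith.of_dist_le_mul (K := L.toNNReal) fun x y => by
    rw [dist_eq_norm, dist_eq_norm, Real.coe_toNNReal _ hL.le]
    exact hBlip x y).continuous
  obtain ⟨c, hc⟩ := FBF.exists_bound_of_limsup_lt hbdd hlimsup_lt
  have hnn : ∀ t, 0 ≤ t → 0 ≤ lam t * bet t := fun t ht =>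
    (mul_pos (hlam t ht).1 (hbet t ht)).le
  have hc0 : 0 ≤ c := (hnn 0 le_rfl).trans (hc 0 le_rfl)
  set k : ℝ := (1 + c * L) * (1 + c * L) + (1 + c * L) with hk
  have hkpos : 0 < k := by positivity
  have hlip : ∀ t, 0 ≤ t → ∀ x y, ‖FBF.fbfField K g B (lam t) (bet t) x
      - FBF.fbfField K g B (lam t) (bet t) y‖ ≤ k * ‖x - y‖ := fun t ht x y =>
    FBF.norm_fbfField_sub_le hgmono hres hL hBlip (hlam t ht).1 (hnn t ht) (hc t ht) x y
  set M : ℝ := (1 + c * L) * (c * ‖B 0‖ + 2 * ‖FBF.bifunResolvent K g α 0‖)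
      + c * ‖B 0‖ + c * ‖B 0‖ with hM
  have hM0 : 0 ≤ M := by positivity
  -- Extension by zero to negative times, so that the Lipschitz, growth and measurability bounds
  -- hold on the whole line.
  let f : ℝ → H → H := fun t x =>
    (Ici (0 : ℝ)).indicator (fun s => FBF.fbfField K g B (lam s) (bet s) x) t
  have hf : ∀ t, 0 ≤ t → ∀ x, f t x = FBF.fbfField K g B (lam t) (bet t) x := fun t ht x =>
    indicator_of_mem (mem_Ici.2 ht) _
  have hf' : ∀ t, ¬ 0 ≤ t → ∀ x, f t x = 0 := fun t ht x => indicator_of_notMem ht _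
  have hflip : ∀ t x y, ‖f t x - f t y‖ ≤ k * ‖x - y‖ := fun t x y => by
    by_cases ht : 0 ≤ t
    · rw [hf t ht, hf t ht]
      exact hlip t ht x y
    · rw [hf' t ht, hf' t ht, sub_self, norm_zero]
      positivity
  have hfM : ∀ t, ‖f t 0‖ ≤ M := fun t => by
    by_cases ht : 0 ≤ t
    · rw [hf t ht]
      exact FBF.norm_fbfField_zero_le hgmono hres hL hBlip (hlam t ht).1 (hlam t ht).2 (hnn t ht)
        (hc t ht)
    · rw [hf' t ht, norm_zero]
      exact hM0
  have hfmeas : ∀ x : ℝ → H, Continuous x →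
      AEStronglyMeasurable (fun t => f t (x t)) volume := fun x hx =>
    (aestronglyMeasurable_indicator_iff measurableSet_Ici).2
      (FBF.aestronglyMeasurable_fbfField hgmono hres hB hlam_meas hbet_meas
        (fun t ht => (hlam t ht).1) hx)
  obtain ⟨x, hxc, hx⟩ := FBF.exists_integral_solution hkpos hflip hfM hfmeas x₀
  have hint := fun a b => FBF.intervalIntegrable_field hflip hfM hfmeas hxc a b
  have hsol : FBF.IsStrongGlobalSolution K g B lam bet x₀ x := by
    refine ⟨fun b hb => ?_, ?_, ?_⟩
    · obtain ⟨C, hC⟩ := isCompact_Icc.exists_bound_of_continuousOn (hxc.continuousOn (s := Icc 0 b))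
      refine FBF.absolutelyContinuousOnInterval_of_eq_integral (C := M + k * C) hb.le hint
        (fun t ht => ?_) hx
      refine (FBF.norm_field_le hflip hfM t (x t)).trans ?_
      have := mul_le_mul_of_nonneg_left (hC t ht) hkpos.le
      linarith
    · filter_upwards [FBF.ae_hasDerivAt_of_eq_integral hint hx,
        ae_restrict_mem measurableSet_Ici] with t h ht
      rwa [hf t ht] at h
    · simpa using hx 0 le_rfl
  refine ⟨x, hsol, fun x' hx' b hb => ?_⟩
  rcases (mem_Ici.1 hb).eq_or_lt with rfl | hpos
  · rw [hx'.initial, hsol.initial]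
  · exact FBF.eq_of_ae_hasDerivAt hlip hpos.le (hx'.locallyAbsolutelyContinuous b hpos)
      (hsol.locallyAbsolutelyContinuous b hpos) hx'.hasDerivAt hsol.hasDerivAt
      (hx'.initial.trans hsol.initial.symm)
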